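/- **Setting.** Consider a state-space model with parameter $\theta\in\Theta$: a latent Markov chain $z=z_{1:T}$ ($T\ge 1$) on a measurable space $\mathsf Z$ with initial density $\mu_\theta$ and transition density $f_\theta(z_{t-1},z_t)$ with respect to a $\sigma$-finite measure $\mathrm dz$, and observation densities $g_\theta(z_t,y_t)$. Fix $y=y_{1:T}$ and put $$p_\theta(z,y)=\mu_\theta(z_1)\prod_{t=2}^T f_\theta(z_{t-1},z_t)\prod_{t=1}^T g_\theta(z_t,y_t),\qquad \ell_\theta(y)=\int p_\theta(z,y)\,\mathrm dz,\qquad \pi_\theta(z)=\frac{p_\theta(z,y)}{\ell_\theta(y)}.$$ Let $\eta$ be a prior density and $q$ a proposal density on $\Theta$, let $\pi(\theta)\propto\eta(\theta)\ell_\theta(y)$, and let $$r(\theta,\theta')=\frac{q(\theta',\theta)\,\pi(\theta')}{q(\theta,\theta')\,\pi(\theta)} .$$ **Conditional SMC.** Let $h_\theta$ be an initial proposal density, $H_\theta(\cdot,\cdot)$ a proposal transition density, and let the particle weights $w_t=w_{\theta,t}\ge 0$ satisfy $$w_1(x)\,h_\theta(x)=\mu_\theta(x)g_\theta(x,y_1),\qquad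 w_t(x')\,H_\theta(x,x')=f_\theta(x,x')g_\theta(x',y_t)\quad(2\le t\le T),$$ so that the weight of a particle is a function of that particle only (for example the bootstrap choice $h_\theta=\mu_\theta$, $H_\theta=f_\theta$, $w_t=g_\theta(\cdot,y_t)$). Given a path $z$ and $M\ge 1$, $\mathrm{cSMC}(M,\theta,z)$ generates particles $\zeta=(\zeta_t^{(i)})_{1\le t\le T,\,1\le i\le M}$ as follows: $\zeta_t^{(1)}=z_t$ for all $t$; $\zeta_1^{(i)}\sim h_\theta$ independently for $i\ge 2$; and for $t\ge 2$, given the particles at time $t-1$, the $\zeta_t^{(i)}$, $i\ge2$, are independent with density $$\sum_{j=1}^M\frac{w_{t-1}(\zeta_{t-1}^{(j)})}{\sum_{l=1}^M w_{t-1}(\zeta_{t-1}^{(l)})}\,H_\theta(\zeta_{t-1}^{(j)},\cdot).$$ **Backward sampling.** For $\mathbf k\in\{1,\dots,M\}^T$ let $\zeta^{(\mathbf k)}=(\zeta_1^{(k_1)},\dots,\zeta_T^{(k_T)})$ and $$\phi_\theta(\mathbf k\mid\zeta)=\frac{w_T(\zeta_T^{(k_T)})}{\sum_{i} w_T(\zeta_T^{(i)})}\prod_{t=1}^{T-1}\frac{w_t(\zeta_t^{(k_t)})f_\theta(\zeta_t^{(k_t)},\zeta_{t+1}^{(k_{t+1})})}{\sum_{i}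 w_t(\zeta_t^{(i)})f_\theta(\zeta_t^{(i)},\zeta_{t+1}^{(k_{t+1})})},\qquad \check\Phi_\theta(\zeta,\cdot)=\sum_{\mathbf k}\phi_\theta(\mathbf k\mid\zeta)\,\delta_{\zeta^{(\mathbf k)}} .$$ **Estimator.** For paths $z,z'$ and particles $\zeta$ let $$\mathring r_{z,z'}(\theta,\theta';\tilde\theta)=\frac{q(\theta',\theta)\eta(\theta')p_{\theta'}(z',y)p_{\tilde\theta}(z,y)}{q(\theta,\theta')\eta(\theta)p_{\tilde\theta}(z',y)p_{\theta}(z,y)},\qquad \mathring r_{z,\zeta}(\theta,\theta';\tilde\theta)=\sum_{\mathbf k}\phi_{\tilde\theta}(\mathbf k\mid\zeta)\,\mathring r_{z,\zeta^{(\mathbf k)}}(\theta,\theta';\tilde\theta).$$ **Claim.** Let $\theta,\theta',\tilde\theta\in\Theta$ be such that $\eta(\theta),\eta(\theta'),q(\theta,\theta'),q(\theta',\theta)>0$, that $0<\ell_\theta(y)<\infty$ and $\ell_{\theta'}(y)<\infty$, and that $p_\theta(\cdot,y)$, $p_{\theta'}(\cdot,y)$ and $p_{\tilde\theta}(\cdot,y)$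 are positive at the same paths $z\in\mathsf Z^T$. Let $M\ge 1$. Then the mechanism $z\sim\pi_\theta$, $\zeta\mid z\sim\mathrm{cSMC}(M,\tilde\theta,z)$, $z'\mid\zeta\sim\check\Phi_{\tilde\theta}(\zeta,\cdot)$ defines a probability distribution of $(z,\zeta,z')$, under which $1/\mathring r_{z',\zeta}(\theta',\theta;\tilde\theta)$ is integrable and $$\mathbb E\left[\frac{1}{\mathring r_{z',\zeta}(\theta',\theta;\tilde\theta)}\right]=r(\theta,\theta').$$ -/

import Mathlib

open MeasureTheory ProbabilityTheory

noncomputable section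

/-- A state-space model: a family, indexed by a parameter `θ`, of latent Markov chains on `Z` with
initial density `init θ` and transition density `trans θ` (with respect to the reference measure
`lam`), observed in `Y` with observation density `obs θ z y`. (That `obs θ z` is normalised as a
function of the observation is not needed here.) -/
structure StateSpaceModel (Θ Y : Type*) {Z : Type*} [MeasurableSpace Z] (lam : Measure Z) where
  init : Θ → Z → ℝ
  trans : Θ → Z → Z → ℝ
  obs : Θ → Z → Y → ℝ
  init_nonneg : ∀ θ z, 0 ≤ init θ z
  trans_nonneg : ∀ θ z z', 0 ≤ trans θ z z'
  obs_nonneg : ∀ θ z y, 0 ≤ obs θ z y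
  measurable_init : ∀ θ, Measurable (init θ)
  measurable_trans : ∀ θ, Measurable (fun x : Z × Z => trans θ x.1 x.2)
  measurable_obs : ∀ θ y, Measurable (fun z => obs θ z y)
  lintegral_init : ∀ θ, ∫⁻ z, ENNReal.ofReal (init θ z) ∂lam = 1
  lintegral_trans : ∀ θ z, ∫⁻ z', ENNReal.ofReal (trans θ z z') ∂lam = 1

/-- The sampling scheme of a particle filter for the model `S` and the observations `y`, over the
`n + 1` times `0, …, n`: an initial proposal density `h θ`, a proposal transition density `H θ`,
and the importance weight `w θ t z` of a particle `z` at time `t`. The weights are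
`w θ 0 z = init θ z * obs θ z (y 0) / h θ z` and, for later times,
`w θ t z' = trans θ z z' * obs θ z' (y t) / H θ z z'`; the quotients are stated as products, which
also says that `h` and `H` charge every point where the numerators are positive. The weight of a
particle is a function of the particle itself and not of its ancestor. The bootstrap filter is
`h = init`, `H = trans`, `w θ t z = obs θ z (y t)`. -/
structure ParticleScheme {Θ Y Z : Type*} [MeasurableSpace Z] {lam : Measure Z}
    (S : StateSpaceModel Θ Y lam) {n : ℕ} (y : Fin (n + 1) → Y) where
  h : Θ → Z → ℝ
  H : Θ → Z → Z → ℝ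
  w : Θ → Fin (n + 1) → Z → ℝ
  h_nonneg : ∀ θ z, 0 ≤ h θ z
  H_nonneg : ∀ θ z z', 0 ≤ H θ z z'
  w_nonneg : ∀ θ t z, 0 ≤ w θ t z
  measurable_h : ∀ θ, Measurable (h θ)
  measurable_H : ∀ θ, Measurable (fun x : Z × Z => H θ x.1 x.2)
  measurable_w : ∀ θ t, Measurable (w θ t)
  lintegral_h : ∀ θ, ∫⁻ z, ENNReal.ofReal (h θ z) ∂lam = 1
  lintegral_H : ∀ θ z, ∫⁻ z', ENNReal.ofReal (H θ z z') ∂lam = 1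
  w_zero : ∀ θ z, w θ 0 z * h θ z = S.init θ z * S.obs θ z (y 0)
  w_succ : ∀ θ (t : Fin n) z z',
    w θ t.succ z' * H θ z z' = S.trans θ z z' * S.obs θ z' (y t.succ)

namespace StateSpaceModel

variable {Θ Y Z : Type*} [MeasurableSpace Z] {lam : Measure Z}
variable (S : StateSpaceModel Θ Y lam) {n : ℕ} (y : Fin (n + 1) → Y)

/-- The joint density `p_θ(z, y)` of the latent path and the observations. -/
def jointDensity (θ : Θ) (z : Fin (n + 1) → Z) : ℝ :=
  S.init θ (z 0) * (∏ t : Fin n, S.trans θ (z t.castSucc) (z t.succ)) *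
    ∏ t : Fin (n + 1), S.obs θ (z t) (y t)

/-- The likelihood `ℓ_θ(y) = ∫ p_θ(z, y) dz`. -/
def likelihood (θ : Θ) : ℝ :=
  ∫ z, S.jointDensity y θ z ∂(Measure.pi fun _ : Fin (n + 1) => lam)

/-- The law `π_θ` of the latent path given the observations, with density `p_θ(z, y) / ℓ_θ(y)`. -/
def posteriorPath (θ : Θ) : Measure (Fin (n + 1) → Z) :=
  (Measure.pi fun _ : Fin (n + 1) => lam).withDensity
    fun z => ENNReal.ofReal (S.jointDensity y θ z / S.likelihood y θ)

/-- The marginal posterior density of the parameter, up to the factor that does not depend on the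
parameter: `π(θ) ∝ η(θ) ℓ_θ(y)`. -/
def posteriorParam (η : Θ → ℝ) (θ : Θ) : ℝ := η θ * S.likelihood y θ

/-- The marginal Metropolis-Hastings acceptance ratio
`r(θ, θ') = q(θ', θ) π(θ') / (q(θ, θ') π(θ))`. -/
def acceptRatio (η : Θ → ℝ) (q : Θ → Θ → ℝ) (θ θ' : Θ) : ℝ :=
  (q θ' θ * S.posteriorParam y η θ') / (q θ θ' * S.posteriorParam y η θ)

/-- The ratio `r̊_{z,z'}(θ, θ'; θt)` for a pair of paths. -/
def pathRatio (η : Θ → ℝ) (q : Θ → Θ → ℝ) (θ θ' θt : Θ) (z z' : Fin (n + 1) → Z) : ℝ :=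
  (q θ' θ * η θ' * S.jointDensity y θ' z' * S.jointDensity y θt z) /
    (q θ θ' * η θ * S.jointDensity y θt z' * S.jointDensity y θ z)

end StateSpaceModel

/-- The path `ζ^(k) = (ζ_t^(k_t))_t` that the indices `k` select in the particle array `ζ`. -/
def selectPath {Z : Type*} {n m : ℕ} (ζ : Fin (n + 1) → Fin (m + 1) → Z)
    (k : Fin (n + 1) → Fin (m + 1)) : Fin (n + 1) → Z :=
  fun t => ζ t (k t)

/-- The array of `m + 1` particles at each time whose particle `0` follows the path `z` and whose
other `m` particles are `u`. -/
def insertPath {Z : Type*} {n m : ℕ} (z : Fin (n + 1) → Z) (u : Fin (n + 1) → Fin m → Z) :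
    Fin (n + 1) → Fin (m + 1) → Z :=
  fun t => Fin.cons (z t) (u t)

namespace ParticleScheme

variable {Θ Y Z : Type*} [MeasurableSpace Z] {lam : Measure Z} {S : StateSpaceModel Θ Y lam}
variable {n m : ℕ} {y : Fin (n + 1) → Y} (P : ParticleScheme S y)

/-- The probability of particle `j` at time `t` in the multinomial resampling step. -/
def resampleProb (θ : Θ) (ζ : Fin (n + 1) → Fin (m + 1) → Z) (t : Fin (n + 1))
    (j : Fin (m + 1)) : ℝ :=
  P.w θ t (ζ t j) / ∑ l, P.w θ t (ζ t l)

/-- The density at `x` of a particle at time `t + 1` given the particles at time `t`: an ancestor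
is drawn by multinomial resampling and moved by the proposal transition `H θ`. -/
def moveDensity (θ : Θ) (ζ : Fin (n + 1) → Fin (m + 1) → Z) (t : Fin n) (x : Z) : ℝ :=
  ∑ j, P.resampleProb θ ζ t.castSucc j * P.H θ (ζ t.castSucc j) x

/-- The joint density of the `m` free particles `u` at all times, in conditional SMC at `θ` given
the path `z`: at each time they are drawn independently, given all particles (the particle of `z`
included) at the previous time. -/
def csmcDensity (θ : Θ) (z : Fin (n + 1) → Z) (u : Fin (n + 1) → Fin m → Z) : ℝ :=
  (∏ i, P.h θ (u 0 i)) *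
    ∏ t : Fin n, ∏ i, P.moveDensity θ (insertPath z u) t (u t.succ i)

/-- The law of all particles of conditional SMC at `θ` given the path `z`, with ancestors
integrated out. -/
def csmcLaw (m : ℕ) (θ : Θ) (z : Fin (n + 1) → Z) : Measure (Fin (n + 1) → Fin (m + 1) → Z) :=
  ((Measure.pi fun _ : Fin (n + 1) => Measure.pi fun _ : Fin m => lam).withDensity
    fun u => ENNReal.ofReal (P.csmcDensity θ z u)).map (insertPath z)

/-- The probability `φ_θ(k | ζ)` that backward sampling draws the indices `k`. -/
def backwardProb (θ : Θ) (ζ : Fin (n + 1) → Fin (m + 1) → Z)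
    (k : Fin (n + 1) → Fin (m + 1)) : ℝ :=
  P.resampleProb θ ζ (Fin.last n) (k (Fin.last n)) *
    ∏ t : Fin n,
      (P.w θ t.castSucc (ζ t.castSucc (k t.castSucc)) *
          S.trans θ (ζ t.castSucc (k t.castSucc)) (ζ t.succ (k t.succ))) /
        ∑ i, P.w θ t.castSucc (ζ t.castSucc i) *
          S.trans θ (ζ t.castSucc i) (ζ t.succ (k t.succ))

/-- The law of the path drawn by backward sampling from the particles `ζ`. -/
def backwardLaw (θ : Θ) (ζ : Fin (n + 1) → Fin (m + 1) → Z) : Measure (Fin (n + 1) → Z) :=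
  ∑ k : Fin (n + 1) → Fin (m + 1),
    ENNReal.ofReal (P.backwardProb θ ζ k) • Measure.dirac (selectPath ζ k)

/-- The estimator `r̊_{z,ζ}(θ, θ'; θt)`: the mean of `r̊_{z,ζ^(k)}(θ, θ'; θt)` over the backward
sampling indices `k` at `θt`. -/
def averagedRatio (η : Θ → ℝ) (q : Θ → Θ → ℝ) (θ θ' θt : Θ) (z : Fin (n + 1) → Z)
    (ζ : Fin (n + 1) → Fin (m + 1) → Z) : ℝ :=
  ∑ k : Fin (n + 1) → Fin (m + 1),
    P.backwardProb θt ζ k * S.pathRatio y η q θ θ' θt z (selectPath ζ k)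

theorem measurable_insertPath_uncurry :
    Measurable (fun x : (Fin (n + 1) → Z) × (Fin (n + 1) → Fin m → Z) =>
      insertPath x.1 x.2) := by
  refine measurable_pi_lambda _ fun t => measurable_pi_lambda _ fun i => ?_
  refine Fin.cases ?_ (fun j => ?_) i
  · simp only [insertPath, Fin.cons_zero]
    fun_prop
  · simp only [insertPath, Fin.cons_succ]
    fun_prop

theorem measurable_resampleProb (θ : Θ) (t : Fin (n + 1)) (j : Fin (m + 1)) :
    Measurable fun ζ : Fin (n + 1) → Fin (m + 1) → Z => P.resampleProb θ ζ t j := by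
  have hw := P.measurable_w θ
  unfold resampleProb
  fun_prop

theorem measurable_csmcDensity (θ : Θ) :
    Measurable (fun x : (Fin (n + 1) → Z) × (Fin (n + 1) → Fin m → Z) =>
      P.csmcDensity θ x.1 x.2) := by
  have hh := P.measurable_h θ
  have hH := P.measurable_H θ
  have hI := measurable_insertPath_uncurry (Z := Z) (n := n) (m := m)
  unfold csmcDensity
  refine Measurable.mul (Finset.measurable_prod _ fun i _ => by fun_prop)
    (Finset.measurable_prod _ fun t _ => Finset.measurable_prod _ fun i _ => ?_)
  unfold moveDensity
  refine Finset.measurable_sum _ fun j _ => Measurable.mul ?_ ?_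
  · exact (P.measurable_resampleProb θ _ j).comp hI
  · refine hH.comp (Measurable.prodMk ?_ (by fun_prop))
    exact (measurable_pi_apply j).comp ((measurable_pi_apply t.castSucc).comp hI)

theorem measurable_backwardProb (θ : Θ) (k : Fin (n + 1) → Fin (m + 1)) :
    Measurable fun ζ : Fin (n + 1) → Fin (m + 1) → Z => P.backwardProb θ ζ k := by
  have hw := P.measurable_w θ
  have hf : ∀ (t t' : Fin (n + 1)) (i i' : Fin (m + 1)),
      Measurable fun ζ : Fin (n + 1) → Fin (m + 1) → Z => S.trans θ (ζ t i) (ζ t' i') :=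
    fun t t' i i' => (S.measurable_trans θ).comp
      (Measurable.prodMk (by fun_prop) (by fun_prop))
  unfold backwardProb
  refine Measurable.mul (P.measurable_resampleProb θ _ _)
    (Finset.measurable_prod _ fun t _ => Measurable.div ?_ ?_)
  · exact Measurable.mul (by fun_prop) (hf _ _ _ _)
  · exact Finset.measurable_sum _ fun i _ => Measurable.mul (by fun_prop) (hf _ _ _ _)

theorem measurable_csmcLaw [SigmaFinite lam] (m : ℕ) (θ : Θ) :
    Measurable (P.csmcLaw m θ) := by
  refine Measure.measurable_of_measurable_coe _ fun s hs => ?_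
  have hI := measurable_insertPath_uncurry (Z := Z) (n := n) (m := m)
  have hD := (P.measurable_csmcDensity (m := m) θ).ennreal_ofReal
  have hz : ∀ z : Fin (n + 1) → Z, Measurable (insertPath (m := m) z) :=
    fun z => hI.comp measurable_prodMk_left
  have key : ∀ z, P.csmcLaw m θ z s = ∫⁻ u, ((fun x : (Fin (n + 1) → Z) ×
        (Fin (n + 1) → Fin m → Z) => insertPath x.1 x.2) ⁻¹' s).indicator
        (fun x => ENNReal.ofReal (P.csmcDensity θ x.1 x.2)) (z, u)
        ∂(Measure.pi fun _ : Fin (n + 1) => Measure.pi fun _ : Fin m => lam) := by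
    intro z
    rw [csmcLaw, Measure.map_apply (hz z) hs, withDensity_apply _ (hz z hs),
      ← lintegral_indicator (hz z hs)]
    rfl
  simp_rw [key]
  exact (hD.indicator (hI hs)).lintegral_prod_right'

theorem measurable_backwardLaw (m : ℕ) (θ : Θ) :
    Measurable (P.backwardLaw (m := m) θ) := by
  refine Measure.measurable_of_measurable_coe _ fun s hs => ?_
  have hsel : ∀ k : Fin (n + 1) → Fin (m + 1),
      Measurable fun ζ : Fin (n + 1) → Fin (m + 1) → Z => selectPath ζ k := by
    intro k
    unfold selectPath
    fun_prop
  simp only [backwardLaw, Measure.coe_finsetSum, Finset.sum_apply, Measure.smul_apply,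
    smul_eq_mul]
  refine Finset.measurable_sum _ fun k _ => ?_
  refine (P.measurable_backwardProb θ k).ennreal_ofReal.mul ?_
  simp_rw [Measure.dirac_apply' _ hs]
  exact (measurable_one.indicator hs).comp (hsel k)

/-- Conditional SMC with `m + 1` particles at `θ`, as a kernel from paths to particle arrays. -/
def csmcKernel [SigmaFinite lam] (m : ℕ) (θ : Θ) :
    Kernel (Fin (n + 1) → Z) (Fin (n + 1) → Fin (m + 1) → Z) where
  toFun := P.csmcLaw m θ
  measurable' := P.measurable_csmcLaw m θ

/-- Backward sampling at `θ`, as a kernel from particle arrays to paths. -/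
def backwardKernel (m : ℕ) (θ : Θ) :
    Kernel (Fin (n + 1) → Fin (m + 1) → Z) (Fin (n + 1) → Z) where
  toFun := P.backwardLaw θ
  measurable' := P.measurable_backwardLaw m θ

/-- The joint law of `(z, ζ, z')` when `z ∼ π_θ`, then `ζ` are the particles of conditional SMC
with `m + 1` particles at `θt` given `z`, then `z'` is drawn from `ζ` by backward sampling
at `θt`. -/
def samplingLaw [SigmaFinite lam] (m : ℕ) (θ θt : Θ) :
    Measure ((Fin (n + 1) → Z) × (Fin (n + 1) → Fin (m + 1) → Z) × (Fin (n + 1) → Z)) :=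
  (S.posteriorPath y θ) ⊗ₘ
    ((P.csmcKernel m θt) ⊗ₖ (Kernel.prodMkLeft (Fin (n + 1) → Z) (P.backwardKernel m θt)))

end ParticleScheme

end

/-! Let `G(ζ)` be the density of an unconditional particle filter at `θt` times the product over
time of its weight sums. The central identity is `G(ζ) φ(0 | ζ) = p_θt(z) · csmc(u | z)` when `ζ` is
`z` (as particle `0`) together with the free particles `u`: conditional SMC followed by backward
sampling reverses the weighted filter (`weightedFilterDensity_mul_backwardProb_zero`).

`G` is invariant under relabelling the particles at each time, so every index vector `k` may be
moved to `0`. Put `A_θ(ζ) = ∑_k φ(k | ζ) p_θ/p_θt(ζ^(k))`. For label-invariant `F`, integrating `F`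
against `p_θ(z) csmc(u | z)` and multiplying by the number of index vectors gives `∫ A_θ G F`
(`lintegral_csmcDensity_eq_lintegral_meanDensityRatio`).

The reciprocal estimator is `c · (p_θ'/p_θt)(z') / A_θ(ζ)`, where `c` collects the prior and
proposal factors. Averaging over the backward draw `z'` turns it into `c · A_θ'/A_θ`, which is
label-invariant. The factor `A_θ` then cancels, leaving `c ∫ A_θ' G`; the same identity read
backwards with `θ'` and a constant `F` gives `c ℓ_θ'`. Dividing by `ℓ_θ` and by the number of index
vectors where it appears yields the acceptance ratio.

Common supports make the cancellation valid where densities vanish, and make the degenerate arrays,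
where conditional SMC or backward sampling would lose mass, negligible. -/

/-! ### Total mass of product densities and Markov chains. -/

theorem lintegral_pi_fin_succ {X : Type*} [MeasurableSpace X] (κ : Measure X) [SigmaFinite κ]
    (n : ℕ) (F : (Fin (n + 1) → X) → ENNReal) (hF : Measurable F) :
    ∫⁻ u, F u ∂(Measure.pi fun _ : Fin (n + 1) => κ) =
      ∫⁻ x, ∫⁻ v, F (Fin.cons x v) ∂(Measure.pi fun _ : Fin n => κ) ∂κ := by
  have h := (measurePreserving_piFinSuccAbove (fun _ : Fin (n + 1) => κ) 0).symm
  rw [← h.lintegral_comp hF]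
  refine (lintegral_prod _ (hF.comp h.measurable).aemeasurable).trans ?_
  simp [MeasurableEquiv.piFinSuccAbove, Fin.insertNthEquiv]

theorem lintegral_pi_fin_prod {X : Type*} [MeasurableSpace X] (κ : Measure X) [SigmaFinite κ]
    (m : ℕ) (f : X → ENNReal) (hf : Measurable f) :
    ∫⁻ u, ∏ i, f (u i) ∂(Measure.pi fun _ : Fin m => κ) = (∫⁻ x, f x ∂κ) ^ m := by
  induction m with
  | zero => simp
  | succ m ih =>
    rw [lintegral_pi_fin_succ κ m _ (by fun_prop)]
    simp_rw [Fin.prod_univ_succ, Fin.cons_zero, Fin.cons_succ]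
    rw [pow_succ', ← ih, ← lintegral_mul_const _ hf]
    exact lintegral_congr fun x => lintegral_const_mul _ (by fun_prop)

theorem lintegral_markov_chain_succ {X : Type*} [MeasurableSpace X] (κ : Measure X)
    [SigmaFinite κ] (n : ℕ) (f : X → ENNReal) (K : Fin (n + 1) → X → X → ENNReal)
    (hf : Measurable f) (hK : ∀ t, Measurable fun x : X × X => K t x.1 x.2) :
    ∫⁻ u, f (u 0) * ∏ t : Fin (n + 1), K t (u t.castSucc) (u t.succ)
        ∂(Measure.pi fun _ : Fin (n + 2) => κ) =
      ∫⁻ x, f x * ∫⁻ v, K 0 x (v 0) * ∏ t : Fin n, K t.succ (v t.castSucc) (v t.succ)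
        ∂(Measure.pi fun _ : Fin (n + 1) => κ) ∂κ := by
  have hp : ∀ (N : ℕ) (i j : Fin N), Measurable fun u : Fin N → X => (u i, u j) :=
    fun N i j => by fun_prop
  have hm : ∀ t : Fin (n + 1), Measurable fun u : Fin (n + 2) → X =>
      K t (u t.castSucc) (u t.succ) := fun t =>
    (hK t).comp (hp _ t.castSucc t.succ)
  have hm' : ∀ t : Fin n, Measurable fun u : Fin (n + 1) → X =>
      K t.succ (u t.castSucc) (u t.succ) := fun t =>
    (hK t.succ).comp (hp _ t.castSucc t.succ)
  rw [lintegral_pi_fin_succ κ (n + 1) _ (by fun_prop)]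
  refine lintegral_congr fun x => ?_
  have h0 : Measurable fun v : Fin (n + 1) → X => K 0 x (v 0) :=
    (hK 0).comp (measurable_const.prodMk (measurable_pi_apply 0))
  rw [← lintegral_const_mul _ (by fun_prop)]
  refine lintegral_congr fun v => ?_
  rw [Fin.prod_univ_succ]
  simp

/-- Once the first state `x` is fixed, the rest is a shorter chain with initial density `K 0 x`;
hence the induction lets `f` vary. -/
theorem lintegral_markov_chain_eq_one {X : Type*} [MeasurableSpace X] (κ : Measure X)
    [SigmaFinite κ] (n : ℕ) (f : X → ENNReal) (K : Fin n → X → X → ENNReal)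
    (hf : Measurable f) (hK : ∀ t, Measurable fun x : X × X => K t x.1 x.2)
    (hf1 : ∫⁻ x, f x ∂κ = 1) (hK1 : ∀ t x, ∫⁻ x', K t x x' ∂κ = 1) :
    ∫⁻ u, f (u 0) * ∏ t : Fin n, K t (u t.castSucc) (u t.succ)
        ∂(Measure.pi fun _ : Fin (n + 1) => κ) = 1 := by
  induction n generalizing f with
  | zero =>
    rw [lintegral_pi_fin_succ κ 0 _ (by simpa using by fun_prop)]
    simpa using hf1
  | succ n ih =>
    rw [lintegral_markov_chain_succ κ n f K hf hK, ← hf1]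
    refine lintegral_congr fun x => ?_
    rw [ih (K 0 x) (fun t => K t.succ) ((hK 0).comp measurable_prodMk_left) (fun t => hK _) (hK1 0 x)
      (fun t => hK1 _), mul_one]

/-- Conditional SMC loses mass when all weights at some time vanish, so for an arbitrary path only
this bound is available; it is enough to make the kernel finite. -/
theorem lintegral_markov_chain_le_one {X : Type*} [MeasurableSpace X] (κ : Measure X)
    [SigmaFinite κ] (n : ℕ) (f : X → ENNReal) (K : Fin n → X → X → ENNReal)
    (hf : Measurable f) (hK : ∀ t, Measurable fun x : X × X => K t x.1 x.2)
    (hf1 : ∫⁻ x, f x ∂κ ≤ 1) (hK1 : ∀ t x, ∫⁻ x', K t x x' ∂κ ≤ 1) :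
    ∫⁻ u, f (u 0) * ∏ t : Fin n, K t (u t.castSucc) (u t.succ)
        ∂(Measure.pi fun _ : Fin (n + 1) => κ) ≤ 1 := by
  induction n generalizing f with
  | zero =>
    rw [lintegral_pi_fin_succ κ 0 _ (by simpa using by fun_prop)]
    simpa using hf1
  | succ n ih =>
    rw [lintegral_markov_chain_succ κ n f K hf hK]
    refine le_trans (lintegral_mono fun x => ?_) hf1
    exact mul_le_of_le_one_right' (ih (K 0 x) (fun t => K t.succ) ((hK 0).comp measurable_prodMk_left)
      (fun t => hK _) (hK1 0 x) (fun t => hK1 _))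

/-- Backward chains of weights on a finite set have total weight one, provided that the kernels
are normalised at the states that carry weight. -/
theorem sum_backward_chain_eq_one {ι : Type*} [Fintype ι] (n : ℕ) (a : ι → ℝ)
    (b : Fin n → ι → ι → ℝ) (w : Fin (n + 1) → ι → ℝ) (ha : ∑ i, a i = 1)
    (haw : ∀ i, a i ≠ 0 → w (Fin.last n) i ≠ 0)
    (hbw : ∀ t i j, b t i j ≠ 0 → w t.castSucc i ≠ 0)
    (hb : ∀ t j, w t.succ j ≠ 0 → ∑ i, b t i j = 1) :
    ∑ k : Fin (n + 1) → ι, a (k (Fin.last n)) * ∏ t : Fin n, b t (k t.castSucc) (k t.succ) = 1 := by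
  induction n generalizing a with
  | zero =>
    rw [← (Equiv.funUnique (Fin 1) ι).symm.sum_comp]
    simpa using ha
  | succ n ih =>
    -- The final index is split off and summed into a new terminal weight `∑ j, a j * b (Fin.last n)
    -- i j`, to which the induction hypothesis applies.
    rw [← (Fin.snocEquiv fun _ => ι).sum_comp, Fintype.sum_prod_type, Finset.sum_comm]
    have h := ih (fun i => ∑ j, a j * b (Fin.last n) i j) (fun t => b t.castSucc)
      (fun t => w t.castSucc) ?_ ?_ (fun t => hbw _) (fun t j hj => hb _ _ hj)
    · rw [← h]
      refine Finset.sum_congr rfl fun k _ => ?_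
      rw [Finset.sum_mul]
      refine Finset.sum_congr rfl fun j _ => ?_
      rw [Fin.prod_univ_castSucc]
      simp only [Fin.snocEquiv, Equiv.coe_fn_mk, Fin.snoc_last, Fin.snoc_castSucc,
        ← Fin.castSucc_succ, Fin.succ_last]
      ring
    · rw [Finset.sum_comm, ← ha]
      refine Finset.sum_congr rfl fun j _ => ?_
      rw [← Finset.mul_sum]
      by_cases hj : a j = 0
      · simp [hj]
      · rw [hb _ _ (by simpa using haw j hj), mul_one]
    · intro i hi
      obtain ⟨j, -, hj⟩ := Finset.exists_ne_zero_of_sum_ne_zero hi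
      exact hbw _ _ _ (right_ne_zero_of_mul hj)

/-! ### Maps of particle arrays that preserve the reference measure. -/

/-- Relabelling the particles at each time. -/
def permuteParticles {Z : Type*} {n m : ℕ} (σ : Fin (n + 1) → Equiv.Perm (Fin (m + 1)))
    (ζ : Fin (n + 1) → Fin (m + 1) → Z) : Fin (n + 1) → Fin (m + 1) → Z :=
  fun t i => ζ t (σ t i)

theorem measurePreserving_permuteParticles {Z : Type*} [MeasurableSpace Z] (lam : Measure Z)
    [SigmaFinite lam] {n m : ℕ} (σ : Fin (n + 1) → Equiv.Perm (Fin (m + 1))) :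
    MeasurePreserving (permuteParticles (Z := Z) σ)
      (Measure.pi fun _ : Fin (n + 1) => Measure.pi fun _ : Fin (m + 1) => lam)
      (Measure.pi fun _ : Fin (n + 1) => Measure.pi fun _ : Fin (m + 1) => lam) := by
  refine measurePreserving_pi _ _ (f := fun t (x : Fin (m + 1) → Z) i => x (σ t i)) fun t => ?_
  exact measurePreserving_arrowCongr' (fun _ => lam) (fun _ => lam) (σ t).symm
    (MeasurableEquiv.refl Z) fun _ => MeasurePreserving.id _

/-- Lets an integral over all particles be read as one over the path of particle `0` and then over
the free particles. Time by time the map is `Fin.cons`, after regrouping the coordinates. -/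
theorem measurePreserving_insertPath {Z : Type*} [MeasurableSpace Z] (lam : Measure Z)
    [SigmaFinite lam] (n m : ℕ) :
    MeasurePreserving
      (fun x : (Fin (n + 1) → Z) × (Fin (n + 1) → Fin m → Z) => insertPath x.1 x.2)
      ((Measure.pi fun _ : Fin (n + 1) => lam).prod
        (Measure.pi fun _ : Fin (n + 1) => Measure.pi fun _ : Fin m => lam))
      (Measure.pi fun _ : Fin (n + 1) => Measure.pi fun _ : Fin (m + 1) => lam) := by
  have h₁ := (measurePreserving_arrowProdEquivProdArrow Z (Fin m → Z) (Fin (n + 1))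
    (fun _ => lam) (fun _ => Measure.pi fun _ : Fin m => lam)).symm
  have h₂ := measurePreserving_pi (fun _ : Fin (n + 1) => lam.prod (Measure.pi fun _ : Fin m => lam))
    (fun _ => Measure.pi fun _ : Fin (m + 1) => lam)
    (fun _ => (measurePreserving_piFinSuccAbove (fun _ : Fin (m + 1) => lam) 0).symm)
  convert h₂.comp h₁ using 1
  funext x t
  simp [insertPath, MeasurableEquiv.piFinSuccAbove, Fin.insertNthEquiv,
    MeasurableEquiv.arrowProdEquivProdArrow, Equiv.arrowProdEquivProdArrow]

/-! ### Densities of the model and the algebra of filter and backward weights. -/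

noncomputable section

namespace StateSpaceModel

variable {Θ Y Z : Type*} [MeasurableSpace Z] {lam : Measure Z}
variable (S : StateSpaceModel Θ Y lam) {n : ℕ} (y : Fin (n + 1) → Y)

theorem jointDensity_nonneg (θ : Θ) (z : Fin (n + 1) → Z) : 0 ≤ S.jointDensity y θ z :=
  mul_nonneg (mul_nonneg (S.init_nonneg _ _) (Finset.prod_nonneg fun _ _ => S.trans_nonneg _ _ _))
    (Finset.prod_nonneg fun _ _ => S.obs_nonneg _ _ _)

theorem measurable_jointDensity (θ : Θ) : Measurable (S.jointDensity y θ) := by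
  have h1 := S.measurable_init θ
  have h2 := fun t => S.measurable_obs θ (y t)
  have h3 : ∀ t : Fin n, Measurable fun z : Fin (n + 1) → Z =>
      S.trans θ (z t.castSucc) (z t.succ) :=
    fun t => (S.measurable_trans θ).comp
      (Measurable.prodMk (measurable_pi_apply _) (measurable_pi_apply _))
  unfold jointDensity
  refine Measurable.mul (Measurable.mul (by fun_prop) (Finset.measurable_fun_prod _ fun t _ => h3 t))
    (Finset.measurable_fun_prod _ fun t _ => (h2 t).comp (measurable_pi_apply t))

theorem ofReal_likelihood (θ : Θ)
    (hint : Integrable (S.jointDensity y θ) (Measure.pi fun _ : Fin (n + 1) => lam)) :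
    ∫⁻ z, ENNReal.ofReal (S.jointDensity y θ z) ∂(Measure.pi fun _ : Fin (n + 1) => lam) =
      ENNReal.ofReal (S.likelihood y θ) :=
  (ofReal_integral_eq_lintegral_ofReal hint (ae_of_all _ (S.jointDensity_nonneg y θ))).symm

end StateSpaceModel

namespace ParticleScheme

variable {Θ Y Z : Type*} [MeasurableSpace Z] {lam : Measure Z} {S : StateSpaceModel Θ Y lam}
variable {n m : ℕ} {y : Fin (n + 1) → Y} (P : ParticleScheme S y)

theorem trans_ne_zero_of_jointDensity_ne_zero (θ : Θ) (z : Fin (n + 1) → Z)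
    (h : S.jointDensity y θ z ≠ 0) (t : Fin n) : S.trans θ (z t.castSucc) (z t.succ) ≠ 0 :=
  Finset.prod_ne_zero_iff.mp (right_ne_zero_of_mul (left_ne_zero_of_mul h)) t (Finset.mem_univ _)

theorem w_ne_zero_of_jointDensity_ne_zero (θ : Θ) (z : Fin (n + 1) → Z)
    (h : S.jointDensity y θ z ≠ 0) (t : Fin (n + 1)) : P.w θ t (z t) ≠ 0 := by
  have hobs := Finset.prod_ne_zero_iff.mp (right_ne_zero_of_mul h)
  refine Fin.cases ?_ (fun t => ?_) t
  · have h0 := mul_ne_zero (left_ne_zero_of_mul (left_ne_zero_of_mul h))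
      (hobs 0 (Finset.mem_univ _))
    rw [← P.w_zero] at h0
    exact left_ne_zero_of_mul h0
  · have h0 := mul_ne_zero (trans_ne_zero_of_jointDensity_ne_zero θ z h t)
      (hobs t.succ (Finset.mem_univ _))
    rw [← P.w_succ] at h0
    exact left_ne_zero_of_mul h0

/-- The sum of the weights of all particles at time `t`. -/
def weightSum (θ : Θ) (ζ : Fin (n + 1) → Fin (m + 1) → Z) (t : Fin (n + 1)) : ℝ :=
  ∑ l, P.w θ t (ζ t l)

/-- The normalising sum of the backward sampling step at time `t` for the successor `x`. -/
def backwardSum (θ : Θ) (ζ : Fin (n + 1) → Fin (m + 1) → Z) (t : Fin n) (x : Z) : ℝ :=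
  ∑ i, P.w θ t.castSucc (ζ t.castSucc i) * S.trans θ (ζ t.castSucc i) x

/-- The density of all particles of the particle filter times the product of the weight sums. -/
def weightedFilterDensity (θ : Θ) (ζ : Fin (n + 1) → Fin (m + 1) → Z) : ℝ :=
  (∏ i, P.h θ (ζ 0 i)) * (∏ t : Fin n, ∏ i, P.moveDensity θ ζ t (ζ t.succ i)) *
    ∏ t, P.weightSum θ ζ t

theorem weightSum_nonneg (θ : Θ) (ζ : Fin (n + 1) → Fin (m + 1) → Z) (t : Fin (n + 1)) :
    0 ≤ P.weightSum θ ζ t :=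
  Finset.sum_nonneg fun _ _ => P.w_nonneg _ _ _

theorem w_eq_zero_of_weightSum_eq_zero {θ : Θ} {ζ : Fin (n + 1) → Fin (m + 1) → Z}
    {t : Fin (n + 1)} (h : P.weightSum θ ζ t = 0) (j : Fin (m + 1)) : P.w θ t (ζ t j) = 0 :=
  (Finset.sum_eq_zero_iff_of_nonneg fun _ _ => P.w_nonneg _ _ _).mp h j (Finset.mem_univ _)

theorem resampleProb_nonneg (θ : Θ) (ζ : Fin (n + 1) → Fin (m + 1) → Z) (t : Fin (n + 1))
    (j : Fin (m + 1)) : 0 ≤ P.resampleProb θ ζ t j :=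
  div_nonneg (P.w_nonneg _ _ _) (P.weightSum_nonneg θ ζ t)

/-- No positivity is needed: a vanishing sum of nonnegative weights forces each weight to vanish, so
both sides are zero. -/
theorem weightSum_mul_resampleProb (θ : Θ) (ζ : Fin (n + 1) → Fin (m + 1) → Z) (t : Fin (n + 1))
    (j : Fin (m + 1)) : P.weightSum θ ζ t * P.resampleProb θ ζ t j = P.w θ t (ζ t j) := by
  by_cases h : P.weightSum θ ζ t = 0
  · rw [h, zero_mul, P.w_eq_zero_of_weightSum_eq_zero h]
  · exact mul_div_cancel₀ _ h

theorem sum_resampleProb {θ : Θ} {ζ : Fin (n + 1) → Fin (m + 1) → Z} {t : Fin (n + 1)}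
    (h : P.weightSum θ ζ t ≠ 0) : ∑ j, P.resampleProb θ ζ t j = 1 := by
  simp only [resampleProb]
  rw [← Finset.sum_div]
  exact div_self h

theorem sum_resampleProb_le_one (θ : Θ) (ζ : Fin (n + 1) → Fin (m + 1) → Z) (t : Fin (n + 1)) :
    ∑ j, P.resampleProb θ ζ t j ≤ 1 := by
  simp only [resampleProb]
  rw [← Finset.sum_div]
  exact div_self_le_one _

theorem moveDensity_nonneg (θ : Θ) (ζ : Fin (n + 1) → Fin (m + 1) → Z) (t : Fin n) (x : Z) :
    0 ≤ P.moveDensity θ ζ t x :=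
  Finset.sum_nonneg fun _ _ => mul_nonneg (P.resampleProb_nonneg _ _ _ _) (P.H_nonneg _ _ _)

theorem backwardSum_nonneg (θ : Θ) (ζ : Fin (n + 1) → Fin (m + 1) → Z) (t : Fin n) (x : Z) :
    0 ≤ P.backwardSum θ ζ t x :=
  Finset.sum_nonneg fun _ _ => mul_nonneg (P.w_nonneg _ _ _) (S.trans_nonneg _ _ _)

theorem weightedFilterDensity_nonneg (θ : Θ) (ζ : Fin (n + 1) → Fin (m + 1) → Z) :
    0 ≤ P.weightedFilterDensity θ ζ :=
  mul_nonneg (mul_nonneg (Finset.prod_nonneg fun _ _ => P.h_nonneg _ _)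
    (Finset.prod_nonneg fun _ _ => Finset.prod_nonneg fun _ _ => P.moveDensity_nonneg _ _ _ _))
    (Finset.prod_nonneg fun _ _ => P.weightSum_nonneg _ _ _)

theorem backwardProb_nonneg (θ : Θ) (ζ : Fin (n + 1) → Fin (m + 1) → Z)
    (k : Fin (n + 1) → Fin (m + 1)) : 0 ≤ P.backwardProb θ ζ k :=
  mul_nonneg (P.resampleProb_nonneg _ _ _ _) (Finset.prod_nonneg fun _ _ => div_nonneg
    (mul_nonneg (P.w_nonneg _ _ _) (S.trans_nonneg _ _ _)) (P.backwardSum_nonneg _ _ _ _))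

theorem backwardProb_le_one (θ : Θ) (ζ : Fin (n + 1) → Fin (m + 1) → Z)
    (k : Fin (n + 1) → Fin (m + 1)) : P.backwardProb θ ζ k ≤ 1 := by
  refine mul_le_one₀ ?_ (Finset.prod_nonneg fun _ _ => div_nonneg
    (mul_nonneg (P.w_nonneg _ _ _) (S.trans_nonneg _ _ _)) (P.backwardSum_nonneg _ _ _ _))
    (Finset.prod_le_one (fun _ _ => div_nonneg
    (mul_nonneg (P.w_nonneg _ _ _) (S.trans_nonneg _ _ _)) (P.backwardSum_nonneg _ _ _ _)) ?_)
  · exact (Finset.single_le_sum (fun j _ => P.resampleProb_nonneg θ ζ _ j)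
      (Finset.mem_univ _)).trans (P.sum_resampleProb_le_one θ ζ _)
  · intro t _
    refine div_le_one_of_le₀ ?_ (P.backwardSum_nonneg _ _ _ _)
    exact Finset.single_le_sum (f := fun i => P.w θ t.castSucc (ζ t.castSucc i) *
      S.trans θ (ζ t.castSucc i) (ζ t.succ (k t.succ)))
      (fun i _ => mul_nonneg (P.w_nonneg _ _ _) (S.trans_nonneg _ _ _)) (Finset.mem_univ _)

/-- The weight sum clears the resampling normaliser, and `w · H = f · g` then trades the proposal
for the transition. Because the weight of `x` ignores its ancestor, it is a common factor of the
sum, and the normaliser of backward sampling appears. -/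
theorem moveDensity_mul_weightSum_mul_w (θ : Θ) (ζ : Fin (n + 1) → Fin (m + 1) → Z) (t : Fin n)
    (x : Z) : P.moveDensity θ ζ t x * P.weightSum θ ζ t.castSucc * P.w θ t.succ x =
      S.obs θ x (y t.succ) * P.backwardSum θ ζ t x := by
  rw [moveDensity, backwardSum, Finset.sum_mul, Finset.sum_mul, Finset.mul_sum]
  refine Finset.sum_congr rfl fun j _ => ?_
  rw [← P.weightSum_mul_resampleProb θ ζ t.castSucc j]
  linear_combination P.weightSum θ ζ t.castSucc * P.resampleProb θ ζ t.castSucc j *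
    P.w_succ θ t (ζ t.castSucc j) x

/-- Conditional SMC followed by backward sampling inverts the particle filter: choosing a path with
density `jointDensity` and completing it by conditional SMC has the same density as drawing all
particles by the (weighted) filter and the path by backward sampling. -/
theorem weightedFilterDensity_mul_backwardProb_zero (θ : Θ) (z : Fin (n + 1) → Z)
    (u : Fin (n + 1) → Fin m → Z) :
    P.weightedFilterDensity θ (insertPath z u) * P.backwardProb θ (insertPath z u) (fun _ => 0) =
      S.jointDensity y θ z * P.csmcDensity θ z u := by
  set ζ := insertPath z u with hζ
  have hz : ∀ t, ζ t 0 = z t := fun t => rfl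
  have hu : ∀ t i, ζ t (Fin.succ i) = u t i := fun t i => rfl
  have key : P.weightedFilterDensity θ ζ * P.backwardProb θ ζ (fun _ => 0) =
      P.csmcDensity θ z u * (S.init θ (z 0) * S.obs θ (z 0) (y 0) *
        ∏ t : Fin n, (S.obs θ (z t.succ) (y t.succ) * (P.backwardSum θ ζ t (z t.succ) *
          (S.trans θ (z t.castSucc) (z t.succ) / P.backwardSum θ ζ t (z t.succ))))) := by
    -- Backward sampling supplies the weights of `z` before the last time, the filter identity
    -- consumes those after the first; the two ways to split the full product reconcile them.
    have hw : (∏ t : Fin n, P.w θ t.castSucc (z t.castSucc)) * P.w θ (Fin.last n) (z (Fin.last n))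
        = P.w θ 0 (z 0) * ∏ t : Fin n, P.w θ t.succ (z t.succ) := by
      rw [← Fin.prod_univ_castSucc fun t => P.w θ t (z t), Fin.prod_univ_succ]
    have hprod : ∏ t : Fin n, (S.obs θ (z t.succ) (y t.succ) * (P.backwardSum θ ζ t (z t.succ) *
        (S.trans θ (z t.castSucc) (z t.succ) / P.backwardSum θ ζ t (z t.succ)))) =
        (∏ t : Fin n, P.moveDensity θ ζ t (z t.succ)) * (∏ t : Fin n, P.weightSum θ ζ t.castSucc) *
        (∏ t : Fin n, P.w θ t.succ (z t.succ)) *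
        ∏ t : Fin n, (S.trans θ (z t.castSucc) (z t.succ) / P.backwardSum θ ζ t (z t.succ)) := by
      simp_rw [← Finset.prod_mul_distrib]
      refine Finset.prod_congr rfl fun t _ => ?_
      rw [P.moveDensity_mul_weightSum_mul_w, mul_assoc]
    have hback : P.backwardProb θ ζ (fun _ => 0) = P.resampleProb θ ζ (Fin.last n) 0 *
        ((∏ t : Fin n, P.w θ t.castSucc (z t.castSucc)) * ∏ t : Fin n,
          (S.trans θ (z t.castSucc) (z t.succ) / P.backwardSum θ ζ t (z t.succ))) := by
      rw [← Finset.prod_mul_distrib, backwardProb]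
      simp only [hz, mul_div_assoc]
      rfl
    have hlast := P.weightSum_mul_resampleProb θ ζ (Fin.last n) 0
    rw [hz] at hlast
    rw [hprod, hback, weightedFilterDensity, csmcDensity, Fin.prod_univ_castSucc (P.weightSum θ ζ),
      ← P.w_zero]
    -- Particle `0`, which is `z`, is separated from the free particles in every product over
    -- particles.
    simp only [Fin.prod_univ_succ (n := m), Finset.prod_mul_distrib, hz, hu, ← hζ]
    generalize (∏ i, P.h θ (u 0 i)) = a at *
    generalize (∏ t : Fin n, ∏ i, P.moveDensity θ ζ t (u t.succ i)) = b at *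
    generalize (∏ t : Fin n, P.moveDensity θ ζ t (z t.succ)) = c at *
    generalize (∏ t : Fin n, P.weightSum θ ζ t.castSucc) = d at *
    generalize (∏ t : Fin n, P.w θ t.castSucc (z t.castSucc)) = e at *
    generalize (∏ t : Fin n, P.w θ t.succ (z t.succ)) = f at *
    generalize (∏ t : Fin n, (S.trans θ (z t.castSucc) (z t.succ) /
      P.backwardSum θ ζ t (z t.succ))) = g at *
    linear_combination P.h θ (z 0) * a * (c * b) * d * e * g * hlast +
      P.h θ (z 0) * a * (c * b) * d * g * hw
  rw [key, mul_comm (S.jointDensity y θ z)]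
  congr 1
  -- If a backward normaliser vanishes, then so does its summand for particle `0`, which forces the
  -- joint density of `z` to be zero; otherwise the normalisers cancel.
  by_cases hD : ∃ t : Fin n, P.backwardSum θ ζ t (z t.succ) = 0
  · obtain ⟨t, ht⟩ := hD
    rw [Finset.prod_eq_zero (Finset.mem_univ t) (by simp [ht]), mul_zero]
    by_contra hne
    have h0 := (Finset.sum_eq_zero_iff_of_nonneg fun _ _ =>
      mul_nonneg (P.w_nonneg _ _ _) (S.trans_nonneg _ _ _)).mp ht 0 (Finset.mem_univ _)
    exact mul_ne_zero (P.w_ne_zero_of_jointDensity_ne_zero θ z (Ne.symm hne) _)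
      (trans_ne_zero_of_jointDensity_ne_zero θ z (Ne.symm hne) t) h0
  · push Not at hD
    rw [StateSpaceModel.jointDensity, Fin.prod_univ_succ (n := n)]
    simp_rw [mul_div_cancel₀ _ (hD _)]
    rw [Finset.prod_mul_distrib]
    ring

/-- A nonzero `weightedFilterDensity` makes every weight sum and every move density nonzero, so
`moveDensity_mul_weightSum_mul_w` gives a nonzero backward normaliser at each particle that carries
weight, the only ones a backward chain can visit. -/
theorem sum_backwardProb {θ : Θ} {ζ : Fin (n + 1) → Fin (m + 1) → Z}
    (h : P.weightedFilterDensity θ ζ ≠ 0) : ∑ k, P.backwardProb θ ζ k = 1 := by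
  have hW := Finset.prod_ne_zero_iff.mp (right_ne_zero_of_mul h)
  refine sum_backward_chain_eq_one n (P.resampleProb θ ζ (Fin.last n))
    (fun t i j => P.w θ t.castSucc (ζ t.castSucc i) * S.trans θ (ζ t.castSucc i) (ζ t.succ j) /
      P.backwardSum θ ζ t (ζ t.succ j)) (fun t i => P.w θ t (ζ t i))
    (P.sum_resampleProb (hW _ (Finset.mem_univ _))) ?_ ?_ ?_
  · exact fun i hi => (div_ne_zero_iff.mp hi).1
  · exact fun t i j hi => left_ne_zero_of_mul (div_ne_zero_iff.mp hi).1
  · intro t j hj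
    rw [← Finset.sum_div]
    refine div_self (show P.backwardSum θ ζ t (ζ t.succ j) ≠ 0 from ?_)
    have hmove := Finset.prod_ne_zero_iff.mp (Finset.prod_ne_zero_iff.mp
      (right_ne_zero_of_mul (left_ne_zero_of_mul h)) t (Finset.mem_univ _)) j (Finset.mem_univ _)
    have h1 := mul_ne_zero (mul_ne_zero hmove (hW t.castSucc (Finset.mem_univ _))) hj
    rw [P.moveDensity_mul_weightSum_mul_w] at h1
    exact right_ne_zero_of_mul h1

/-! ### Measurability, and the total mass of conditional SMC. -/

theorem measurable_moveDensity (θ : Θ) (t : Fin n) :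
    Measurable fun x : (Fin (n + 1) → Fin (m + 1) → Z) × Z => P.moveDensity θ x.1 t x.2 := by
  unfold moveDensity
  refine Finset.measurable_fun_sum _ fun j _ =>
    ((P.measurable_resampleProb θ _ j).comp measurable_fst).mul ?_
  exact (P.measurable_H θ).comp (Measurable.prodMk (by fun_prop) measurable_snd)

theorem measurable_weightedFilterDensity (θ : Θ) :
    Measurable (P.weightedFilterDensity (m := m) θ) := by
  have hh := P.measurable_h θ
  have hw := P.measurable_w θ
  have hm : ∀ (t : Fin n) (i : Fin (m + 1)), Measurable
      fun ζ : Fin (n + 1) → Fin (m + 1) → Z => P.moveDensity θ ζ t (ζ t.succ i) :=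
    fun t i => (P.measurable_moveDensity θ t).comp (measurable_id.prodMk (by fun_prop))
  unfold weightedFilterDensity weightSum
  fun_prop

theorem lintegral_moveDensity (θ : Θ) (ζ : Fin (n + 1) → Fin (m + 1) → Z) (t : Fin n) :
    ∫⁻ x, ENNReal.ofReal (P.moveDensity θ ζ t x) ∂lam =
      ENNReal.ofReal (∑ j, P.resampleProb θ ζ t.castSucc j) := by
  have hH : ∀ z, Measurable (P.H θ z) := fun z => (P.measurable_H θ).comp measurable_prodMk_left
  simp only [moveDensity]
  simp_rw [ENNReal.ofReal_sum_of_nonneg fun j _ =>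
    mul_nonneg (P.resampleProb_nonneg θ ζ t.castSucc j) (P.H_nonneg θ _ _)]
  rw [lintegral_finsetSum _ fun j _ => by fun_prop,
    ENNReal.ofReal_sum_of_nonneg fun j _ => P.resampleProb_nonneg θ ζ t.castSucc j]
  refine Finset.sum_congr rfl fun j _ => ?_
  simp_rw [ENNReal.ofReal_mul (P.resampleProb_nonneg θ ζ t.castSucc j)]
  rw [lintegral_const_mul _ (hH _).ennreal_ofReal, P.lintegral_H, mul_one]

/-- The transition kernel density of the free particles of conditional SMC. -/
def csmcStep (θ : Θ) (z : Fin (n + 1) → Z) (t : Fin n) (x x' : Fin m → Z) : ENNReal :=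
  -- `moveDensity` at `t` reads only the particles at time `t.castSucc`, so repeating `x` at all
  -- times is harmless and exhibits the free particles as a Markov chain.
  ∏ i, ENNReal.ofReal (P.moveDensity θ (insertPath z fun _ => x) t (x' i))

theorem measurable_csmcStep (θ : Θ) (z : Fin (n + 1) → Z) (t : Fin n) :
    Measurable fun x : (Fin m → Z) × (Fin m → Z) => P.csmcStep θ z t x.1 x.2 := by
  unfold csmcStep
  refine Finset.measurable_fun_prod _ fun i _ => Measurable.ennreal_ofReal ?_
  refine (P.measurable_moveDensity θ t).comp (Measurable.prodMk ?_ (by fun_prop))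
  exact measurable_insertPath_uncurry.comp (measurable_const.prodMk
    (measurable_pi_lambda _ fun _ => measurable_fst))

theorem ofReal_csmcDensity (θ : Θ) (z : Fin (n + 1) → Z) (u : Fin (n + 1) → Fin m → Z) :
    ENNReal.ofReal (P.csmcDensity θ z u) = (∏ i, ENNReal.ofReal (P.h θ (u 0 i))) *
      ∏ t : Fin n, P.csmcStep θ z t (u t.castSucc) (u t.succ) := by
  rw [csmcDensity, ENNReal.ofReal_mul (Finset.prod_nonneg fun _ _ => P.h_nonneg _ _),
    ENNReal.ofReal_prod_of_nonneg fun _ _ => P.h_nonneg _ _,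
    ENNReal.ofReal_prod_of_nonneg fun _ _ => Finset.prod_nonneg fun _ _ =>
      P.moveDensity_nonneg _ _ _ _]
  simp_rw [ENNReal.ofReal_prod_of_nonneg fun _ _ => P.moveDensity_nonneg _ _ _ _]
  rfl

theorem lintegral_csmcLaw (θ : Θ) (z : Fin (n + 1) → Z)
    (F : (Fin (n + 1) → Fin (m + 1) → Z) → ENNReal) (hF : Measurable F) :
    ∫⁻ ζ, F ζ ∂(P.csmcLaw m θ z) =
      ∫⁻ u, ENNReal.ofReal (P.csmcDensity θ z u) * F (insertPath z u)
        ∂(Measure.pi fun _ : Fin (n + 1) => Measure.pi fun _ : Fin m => lam) := by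
  have hI : Measurable (insertPath (m := m) z) :=
    measurable_insertPath_uncurry.comp measurable_prodMk_left
  rw [csmcLaw, lintegral_map hF hI]
  exact lintegral_withDensity_eq_lintegral_mul _
    ((P.measurable_csmcDensity θ).comp measurable_prodMk_left).ennreal_ofReal (hF.comp hI)

theorem lintegral_backwardLaw (θ : Θ) (ζ : Fin (n + 1) → Fin (m + 1) → Z)
    (F : (Fin (n + 1) → Z) → ENNReal) (hF : Measurable F) :
    ∫⁻ z, F z ∂(P.backwardLaw θ ζ) =
      ∑ k, ENNReal.ofReal (P.backwardProb θ ζ k) * F (selectPath ζ k) := by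
  simp only [backwardLaw, lintegral_finsetSum_measure, lintegral_smul_measure, smul_eq_mul,
    lintegral_dirac' _ hF]

instance isFiniteKernel_backwardKernel (θ : Θ) : IsFiniteKernel (P.backwardKernel m θ) := by
  refine ⟨⟨∑ _k : Fin (n + 1) → Fin (m + 1), 1, by simp, fun ζ => ?_⟩⟩
  have h := P.lintegral_backwardLaw θ ζ (fun _ => 1) measurable_const
  rw [lintegral_one] at h
  change P.backwardLaw θ ζ Set.univ ≤ _
  rw [h]
  refine Finset.sum_le_sum fun k _ => ?_
  simpa using P.backwardProb_le_one θ ζ k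

variable [SigmaFinite lam]

theorem lintegral_prod_h (θ : Θ) : ∫⁻ x : Fin m → Z, ∏ i, ENNReal.ofReal (P.h θ (x i))
    ∂(Measure.pi fun _ : Fin m => lam) = 1 := by
  rw [lintegral_pi_fin_prod lam m _ (P.measurable_h θ).ennreal_ofReal, P.lintegral_h, one_pow]

theorem lintegral_csmcStep (θ : Θ) (z : Fin (n + 1) → Z) (t : Fin n) (x : Fin m → Z) :
    ∫⁻ x', P.csmcStep θ z t x x' ∂(Measure.pi fun _ : Fin m => lam) =
      ENNReal.ofReal (∑ j, P.resampleProb θ (insertPath z fun _ => x) t.castSucc j) ^ m := by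
  unfold csmcStep
  rw [lintegral_pi_fin_prod lam m
    (fun x' => ENNReal.ofReal (P.moveDensity θ (insertPath z fun _ => x) t x'))
    ((P.measurable_moveDensity θ t).comp measurable_prodMk_left).ennreal_ofReal,
    P.lintegral_moveDensity]

theorem lintegral_csmcDensity_le_one (θ : Θ) (z : Fin (n + 1) → Z) :
    ∫⁻ u, ENNReal.ofReal (P.csmcDensity θ z u)
      ∂(Measure.pi fun _ : Fin (n + 1) => Measure.pi fun _ : Fin m => lam) ≤ 1 := by
  have hh := P.measurable_h θ
  simp_rw [P.ofReal_csmcDensity]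
  refine lintegral_markov_chain_le_one _ n (fun x => ∏ i, ENNReal.ofReal (P.h θ (x i)))
    (P.csmcStep θ z) (by fun_prop) (P.measurable_csmcStep θ z) (P.lintegral_prod_h θ).le ?_
  intro t x
  rw [P.lintegral_csmcStep]
  exact pow_le_one₀ zero_le (ENNReal.ofReal_le_one.mpr (P.sum_resampleProb_le_one _ _ _))

/-- Along a path of nonzero joint density the retained particle has nonzero weight at every time, so
resampling is never degenerate. -/
theorem lintegral_csmcDensity_eq_one (θ : Θ) (z : Fin (n + 1) → Z)
    (hz : S.jointDensity y θ z ≠ 0) :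
    ∫⁻ u, ENNReal.ofReal (P.csmcDensity θ z u)
      ∂(Measure.pi fun _ : Fin (n + 1) => Measure.pi fun _ : Fin m => lam) = 1 := by
  have hh := P.measurable_h θ
  simp_rw [P.ofReal_csmcDensity]
  refine lintegral_markov_chain_eq_one _ n (fun x => ∏ i, ENNReal.ofReal (P.h θ (x i)))
    (P.csmcStep θ z) (by fun_prop) (P.measurable_csmcStep θ z) (P.lintegral_prod_h θ) ?_
  intro t x
  rw [P.lintegral_csmcStep, P.sum_resampleProb, ENNReal.ofReal_one, one_pow]
  exact fun h => P.w_ne_zero_of_jointDensity_ne_zero θ z hz t.castSucc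
    (P.w_eq_zero_of_weightSum_eq_zero h 0)

instance isFiniteKernel_csmcKernel (θ : Θ) : IsFiniteKernel (P.csmcKernel m θ) := by
  refine ⟨⟨1, ENNReal.one_lt_top, fun z => ?_⟩⟩
  have h := P.lintegral_csmcLaw (m := m) θ z (fun _ => 1) measurable_const
  rw [lintegral_one] at h
  change P.csmcLaw m θ z Set.univ ≤ 1
  rw [h]
  simpa using P.lintegral_csmcDensity_le_one θ z

/-! ### The joint law as an iterated integral. -/

theorem lintegral_samplingLaw (θ θt : Θ)
    (F : (Fin (n + 1) → Fin (m + 1) → Z) × (Fin (n + 1) → Z) → ENNReal) (hF : Measurable F) :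
    ∫⁻ x, F x.2 ∂(P.samplingLaw m θ θt) =
      ∫⁻ z, ENNReal.ofReal (S.jointDensity y θ z / S.likelihood y θ) *
        ∫⁻ u, ENNReal.ofReal (P.csmcDensity θt z u) *
          ∑ k, ENNReal.ofReal (P.backwardProb θt (insertPath z u) k) *
            F (insertPath z u, selectPath (insertPath z u) k)
          ∂(Measure.pi fun _ : Fin (n + 1) => Measure.pi fun _ : Fin m => lam)
        ∂(Measure.pi fun _ : Fin (n + 1) => lam) := by
  have hS : Measurable fun x : (Fin (n + 1) → Fin (m + 1) → Z) =>
      ∑ k, ENNReal.ofReal (P.backwardProb θt x k) * F (x, selectPath x k) := by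
    refine Finset.measurable_fun_sum _ fun k _ =>
      (P.measurable_backwardProb θt k).ennreal_ofReal.mul (hF.comp (measurable_id.prodMk ?_))
    unfold selectPath
    fun_prop
  have hI := measurable_insertPath_uncurry (Z := Z) (n := n) (m := m)
  have : SFinite (S.posteriorPath y θ) := by
    unfold StateSpaceModel.posteriorPath
    infer_instance
  rw [samplingLaw, Measure.lintegral_compProd (f := fun x => F x.2) (hF.comp measurable_snd),
    StateSpaceModel.posteriorPath]
  have hinner : ∀ z, ∫⁻ b, F b ∂((P.csmcKernel m θt) ⊗ₖ (Kernel.prodMkLeft (Fin (n + 1) → Z)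
      (P.backwardKernel m θt))) z = ∫⁻ u, ENNReal.ofReal (P.csmcDensity θt z u) *
          ∑ k, ENNReal.ofReal (P.backwardProb θt (insertPath z u) k) *
            F (insertPath z u, selectPath (insertPath z u) k)
          ∂(Measure.pi fun _ : Fin (n + 1) => Measure.pi fun _ : Fin m => lam) := by
    intro z
    rw [Kernel.lintegral_compProd _ _ _ hF, ← P.lintegral_csmcLaw θt z _ hS]
    exact lintegral_congr fun ζ =>
      P.lintegral_backwardLaw θt ζ _ (hF.comp measurable_prodMk_left)
  simp_rw [hinner]
  refine lintegral_withDensity_eq_lintegral_mul _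
    ((S.measurable_jointDensity y θ).div_const _).ennreal_ofReal ?_
  exact ((P.measurable_csmcDensity θt).ennreal_ofReal.mul (hS.comp hI)).lintegral_prod_right'

end ParticleScheme

/-! ### Invariance under relabelling, and the shape of the estimator. -/

namespace ParticleScheme

variable {Θ Y Z : Type*} [MeasurableSpace Z] {lam : Measure Z} {S : StateSpaceModel Θ Y lam}
variable {n m : ℕ} {y : Fin (n + 1) → Y} (P : ParticleScheme S y)

theorem resampleProb_permuteParticles (θ : Θ) (ζ : Fin (n + 1) → Fin (m + 1) → Z)
    (σ : Fin (n + 1) → Equiv.Perm (Fin (m + 1))) (t : Fin (n + 1)) (j : Fin (m + 1)) :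
    P.resampleProb θ (permuteParticles σ ζ) t j = P.resampleProb θ ζ t (σ t j) := by
  simp only [resampleProb, permuteParticles]
  rw [Equiv.sum_comp (σ t) fun l => P.w θ t (ζ t l)]

theorem moveDensity_permuteParticles (θ : Θ) (ζ : Fin (n + 1) → Fin (m + 1) → Z)
    (σ : Fin (n + 1) → Equiv.Perm (Fin (m + 1))) (t : Fin n) (x : Z) :
    P.moveDensity θ (permuteParticles σ ζ) t x = P.moveDensity θ ζ t x := by
  simp only [moveDensity, resampleProb_permuteParticles]
  exact Equiv.sum_comp (σ t.castSucc) fun j =>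
    P.resampleProb θ ζ t.castSucc j * P.H θ (ζ t.castSucc j) x

theorem weightedFilterDensity_permuteParticles (θ : Θ) (ζ : Fin (n + 1) → Fin (m + 1) → Z)
    (σ : Fin (n + 1) → Equiv.Perm (Fin (m + 1))) :
    P.weightedFilterDensity θ (permuteParticles σ ζ) = P.weightedFilterDensity θ ζ := by
  simp only [weightedFilterDensity, moveDensity_permuteParticles]
  congr 2
  · exact Equiv.prod_comp (σ 0) fun i => P.h θ (ζ 0 i)
  · exact Finset.prod_congr rfl fun t _ =>
      Equiv.prod_comp (σ t.succ) fun i => P.moveDensity θ ζ t (ζ t.succ i)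
  · exact funext fun t => Equiv.sum_comp (σ t) fun l => P.w θ t (ζ t l)

theorem backwardProb_permuteParticles (θ : Θ) (ζ : Fin (n + 1) → Fin (m + 1) → Z)
    (σ : Fin (n + 1) → Equiv.Perm (Fin (m + 1))) (k : Fin (n + 1) → Fin (m + 1)) :
    P.backwardProb θ (permuteParticles σ ζ) k = P.backwardProb θ ζ fun t => σ t (k t) := by
  rw [backwardProb, backwardProb, resampleProb_permuteParticles]
  congr 1
  refine Finset.prod_congr rfl fun t _ => ?_
  congr 1
  exact Equiv.sum_comp (σ t.castSucc) fun i => P.w θ t.castSucc (ζ t.castSucc i) *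
    S.trans θ (ζ t.castSucc i) (ζ t.succ (σ t.succ (k t.succ)))

/-- The mean of the density ratio `p_θ / p_θt` over the paths drawn by backward sampling at `θt`. -/
def meanDensityRatio (θ θt : Θ) (ζ : Fin (n + 1) → Fin (m + 1) → Z) : ℝ :=
  ∑ k, P.backwardProb θt ζ k *
    (S.jointDensity y θ (selectPath ζ k) / S.jointDensity y θt (selectPath ζ k))

theorem meanDensityRatio_permuteParticles (θ θt : Θ) (ζ : Fin (n + 1) → Fin (m + 1) → Z)
    (σ : Fin (n + 1) → Equiv.Perm (Fin (m + 1))) :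
    P.meanDensityRatio θ θt (permuteParticles σ ζ) = P.meanDensityRatio θ θt ζ := by
  simp only [meanDensityRatio, backwardProb_permuteParticles]
  exact (Equiv.piCongrRight σ).sum_comp fun k => P.backwardProb θt ζ k *
    (S.jointDensity y θ (selectPath ζ k) / S.jointDensity y θt (selectPath ζ k))

theorem backwardProb_mul_densityRatio_nonneg (θ θt : Θ) (ζ : Fin (n + 1) → Fin (m + 1) → Z)
    (k : Fin (n + 1) → Fin (m + 1)) : 0 ≤ P.backwardProb θt ζ k *
      (S.jointDensity y θ (selectPath ζ k) / S.jointDensity y θt (selectPath ζ k)) :=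
  mul_nonneg (P.backwardProb_nonneg _ _ _)
    (div_nonneg (S.jointDensity_nonneg _ _ _) (S.jointDensity_nonneg _ _ _))

theorem meanDensityRatio_nonneg (θ θt : Θ) (ζ : Fin (n + 1) → Fin (m + 1) → Z) :
    0 ≤ P.meanDensityRatio θ θt ζ :=
  Finset.sum_nonneg fun k _ => P.backwardProb_mul_densityRatio_nonneg θ θt ζ k

/-- Allows `A_θ · (A_θ' / A_θ) = A_θ'` at every array, including those where `A_θ` is zero: its
terms are nonnegative, so each of them vanishes, and with it the corresponding term for `θ'`. -/
theorem meanDensityRatio_eq_zero {θ θ' θt : Θ} {ζ : Fin (n + 1) → Fin (m + 1) → Z}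
    (hsupp : ∀ z, S.jointDensity y θ z = 0 → S.jointDensity y θ' z = 0)
    (h : P.meanDensityRatio θ θt ζ = 0) : P.meanDensityRatio θ' θt ζ = 0 := by
  refine Finset.sum_eq_zero fun k _ => ?_
  have h0 := (Finset.sum_eq_zero_iff_of_nonneg fun k _ =>
    P.backwardProb_mul_densityRatio_nonneg θ θt ζ k).mp h k (Finset.mem_univ _)
  rcases mul_eq_zero.mp h0 with h1 | h1
  · rw [h1, zero_mul]
  · rcases div_eq_zero_iff.mp h1 with h2 | h2
    · rw [hsupp _ h2, zero_div, mul_zero]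
    · rw [h2, div_zero, mul_zero]

theorem measurable_selectPath (k : Fin (n + 1) → Fin (m + 1)) :
    Measurable fun ζ : Fin (n + 1) → Fin (m + 1) → Z => selectPath ζ k := by
  unfold selectPath
  fun_prop

theorem measurable_backwardProb_mul_densityRatio (θ θt : Θ) (k : Fin (n + 1) → Fin (m + 1)) :
    Measurable fun ζ : Fin (n + 1) → Fin (m + 1) → Z => P.backwardProb θt ζ k *
      (S.jointDensity y θ (selectPath ζ k) / S.jointDensity y θt (selectPath ζ k)) :=
  (P.measurable_backwardProb θt k).mul
    (((S.measurable_jointDensity y θ).comp (measurable_selectPath k)).div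
      ((S.measurable_jointDensity y θt).comp (measurable_selectPath k)))

theorem measurable_meanDensityRatio (θ θt : Θ) :
    Measurable (P.meanDensityRatio (m := m) θ θt) :=
  Finset.measurable_fun_sum _ fun k _ => P.measurable_backwardProb_mul_densityRatio θ θt k

/-- The path ratio is a function of `z` times a function of the selected path, so averaging over the
indices affects the second factor alone. The parameters are taken in the order `θ'`, `θ`, as in the
reciprocal estimator. -/
theorem averagedRatio_eq (η : Θ → ℝ) (q : Θ → Θ → ℝ) (θ θ' θt : Θ) (z : Fin (n + 1) → Z)
    (ζ : Fin (n + 1) → Fin (m + 1) → Z) :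
    P.averagedRatio η q θ' θ θt z ζ = (q θ θ' * η θ / (q θ' θ * η θ')) *
      (S.jointDensity y θt z / S.jointDensity y θ' z) * P.meanDensityRatio θ θt ζ := by
  rw [averagedRatio, meanDensityRatio, Finset.mul_sum]
  refine Finset.sum_congr rfl fun k _ => ?_
  rw [StateSpaceModel.pathRatio]
  simp only [div_eq_mul_inv, mul_inv]
  ring

theorem one_div_averagedRatio_eq (η : Θ → ℝ) (q : Θ → Θ → ℝ) (θ θ' θt : Θ) (z : Fin (n + 1) → Z)
    (ζ : Fin (n + 1) → Fin (m + 1) → Z) :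
    1 / P.averagedRatio η q θ' θ θt z ζ = (q θ' θ * η θ' / (q θ θ' * η θ)) *
      ((S.jointDensity y θ' z / S.jointDensity y θt z) / P.meanDensityRatio θ θt ζ) := by
  rw [averagedRatio_eq, one_div, mul_inv, mul_inv, inv_div, inv_div, div_eq_mul_inv _
    (P.meanDensityRatio θ θt ζ), mul_assoc]

theorem measurable_averagedRatio (η : Θ → ℝ) (q : Θ → Θ → ℝ) (θ θ' θt : Θ) :
    Measurable fun x : (Fin (n + 1) → Fin (m + 1) → Z) × (Fin (n + 1) → Z) =>
      P.averagedRatio η q θ' θ θt x.2 x.1 := by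
  simp_rw [P.averagedRatio_eq η q θ θ' θt]
  exact (measurable_const.mul (((S.measurable_jointDensity y θt).comp measurable_snd).div
    ((S.measurable_jointDensity y θ').comp measurable_snd))).mul
    ((P.measurable_meanDensityRatio θ θt).comp measurable_fst)

/-! ### Change of measure to the weighted filter, and the expectation. -/

variable [SigmaFinite lam]

/-- For a function of the particles that does not depend on their labels, averaging over conditional
SMC at `θt` given a path of density `p_θ` amounts to weighting the particle filter at `θt` by the
backward sampling mean of `p_θ / p_θt`. -/
theorem lintegral_csmcDensity_eq_lintegral_meanDensityRatio (θ θt : Θ)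
    (hsupp : ∀ z, S.jointDensity y θt z = 0 → S.jointDensity y θ z = 0)
    (F : (Fin (n + 1) → Fin (m + 1) → Z) → ENNReal) (hF : Measurable F)
    (hFs : ∀ σ ζ, F (permuteParticles σ ζ) = F ζ) :
    (Fintype.card (Fin (n + 1) → Fin (m + 1)) : ENNReal) *
      ∫⁻ z, ENNReal.ofReal (S.jointDensity y θ z) *
        ∫⁻ u, ENNReal.ofReal (P.csmcDensity θt z u) * F (insertPath z u)
          ∂(Measure.pi fun _ : Fin (n + 1) => Measure.pi fun _ : Fin m => lam)
        ∂(Measure.pi fun _ : Fin (n + 1) => lam) =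
      ∫⁻ ζ, ENNReal.ofReal (P.meanDensityRatio θ θt ζ * P.weightedFilterDensity θt ζ) * F ζ
        ∂(Measure.pi fun _ : Fin (n + 1) => Measure.pi fun _ : Fin (m + 1) => lam) := by
  let Q : (Fin (n + 1) → Fin (m + 1)) → (Fin (n + 1) → Fin (m + 1) → Z) → ENNReal := fun k ζ =>
    ENNReal.ofReal (P.backwardProb θt ζ k *
      (S.jointDensity y θ (selectPath ζ k) / S.jointDensity y θt (selectPath ζ k)) *
      P.weightedFilterDensity θt ζ) * F ζ
  have hQ : ∀ k, Measurable (Q k) := fun k =>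
    ((P.measurable_backwardProb_mul_densityRatio θ θt k).mul
      (P.measurable_weightedFilterDensity θt)).ennreal_ofReal.mul hF
  have hsum : ∀ ζ, ENNReal.ofReal (P.meanDensityRatio θ θt ζ * P.weightedFilterDensity θt ζ) * F ζ =
      ∑ k, Q k ζ := by
    intro ζ
    rw [meanDensityRatio, Finset.sum_mul, ENNReal.ofReal_sum_of_nonneg, Finset.sum_mul]
    exact fun k _ => mul_nonneg (P.backwardProb_mul_densityRatio_nonneg θ θt ζ k)
      (P.weightedFilterDensity_nonneg θt ζ)
  have hzero : ∀ k, ∫⁻ ζ, Q k ζ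
        ∂(Measure.pi fun _ : Fin (n + 1) => Measure.pi fun _ : Fin (m + 1) => lam) =
      ∫⁻ ζ, Q (fun _ => 0) ζ
        ∂(Measure.pi fun _ : Fin (n + 1) => Measure.pi fun _ : Fin (m + 1) => lam) := by
    intro k
    -- Swapping labels `0` and `k t` at each time `t` carries the index vector `0` to `k`.
    rw [← (measurePreserving_permuteParticles lam fun t => Equiv.swap 0 (k t)).lintegral_comp
      (hQ fun _ => 0)]
    refine lintegral_congr fun ζ => ?_
    have hk : (fun t => Equiv.swap 0 (k t) 0) = k := funext fun t => Equiv.swap_apply_left _ _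
    have hsel : selectPath (permuteParticles (fun t => Equiv.swap 0 (k t)) ζ) (fun _ => 0) =
        selectPath ζ k := by
      funext t
      simp [selectPath, permuteParticles]
    simp only [Q, hFs, P.backwardProb_permuteParticles, hsel, hk,
      P.weightedFilterDensity_permuteParticles]
  simp_rw [hsum]
  rw [lintegral_finsetSum _ fun k _ => hQ k, Finset.sum_congr rfl fun k _ => hzero k,
    Finset.sum_const, Finset.card_univ, nsmul_eq_mul]
  congr 1
  have hI := measurePreserving_insertPath lam n m
  rw [← hI.lintegral_comp (hQ _)]
  refine Eq.trans ?_ (lintegral_prod _ ((hQ _).comp hI.measurable).aemeasurable).symm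
  refine lintegral_congr fun z => ?_
  have hm : Measurable fun u : Fin (n + 1) → Fin m → Z =>
      ENNReal.ofReal (P.csmcDensity θt z u) * F (insertPath z u) :=
    (((P.measurable_csmcDensity θt).ennreal_ofReal).mul (hF.comp hI.measurable)).comp
      measurable_prodMk_left
  rw [← lintegral_const_mul _ hm]
  refine lintegral_congr fun u => ?_
  rw [← mul_assoc, ← ENNReal.ofReal_mul (S.jointDensity_nonneg y θ z)]
  congr 2
  change _ = P.backwardProb θt (insertPath z u) (fun _ => 0) *
      (S.jointDensity y θ z / S.jointDensity y θt z) * P.weightedFilterDensity θt (insertPath z u)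
  have hG := P.weightedFilterDensity_mul_backwardProb_zero θt z u
  -- Dividing the central identity by `p_θt(z)` needs it nonzero; where it vanishes, so does
  -- `p_θ(z)`, and both sides are zero.
  by_cases h0 : S.jointDensity y θt z = 0
  · simp [h0, hsupp z h0]
  · field_simp
    linear_combination -S.jointDensity y θ z * hG

theorem lintegral_jointDensity_mul_csmcDensity (θ θt : Θ)
    (hsupp : ∀ z, S.jointDensity y θt z = 0 → S.jointDensity y θ z = 0) :
    ∫⁻ z, ENNReal.ofReal (S.jointDensity y θ z) *
        ∫⁻ u, ENNReal.ofReal (P.csmcDensity θt z u)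
          ∂(Measure.pi fun _ : Fin (n + 1) => Measure.pi fun _ : Fin m => lam)
        ∂(Measure.pi fun _ : Fin (n + 1) => lam) =
      ∫⁻ z, ENNReal.ofReal (S.jointDensity y θ z) ∂(Measure.pi fun _ : Fin (n + 1) => lam) := by
  refine lintegral_congr fun z => ?_
  by_cases h0 : S.jointDensity y θt z = 0
  · simp [hsupp z h0]
  · rw [P.lintegral_csmcDensity_eq_one θt z h0, mul_one]

theorem isProbabilityMeasure_samplingLaw (θ θt : Θ)
    (hint : Integrable (S.jointDensity y θ) (Measure.pi fun _ : Fin (n + 1) => lam))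
    (hpos : 0 < S.likelihood y θ)
    (hsupp : ∀ z, S.jointDensity y θt z = 0 → S.jointDensity y θ z = 0) :
    IsProbabilityMeasure (P.samplingLaw m θ θt) := by
  refine ⟨?_⟩
  rw [← lintegral_one, P.lintegral_samplingLaw θ θt (fun _ => 1) measurable_const]
  have hL : ENNReal.ofReal (S.likelihood y θ) ≠ 0 := by simpa using hpos
  have h1 : ∫⁻ z, ENNReal.ofReal (S.jointDensity y θ z) * (ENNReal.ofReal (S.likelihood y θ))⁻¹
      ∂(Measure.pi fun _ : Fin (n + 1) => lam) = 1 := by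
    rw [lintegral_mul_const _ (S.measurable_jointDensity y θ).ennreal_ofReal,
      S.ofReal_likelihood y θ hint, ENNReal.mul_inv_cancel hL ENNReal.ofReal_ne_top]
  refine Eq.trans (lintegral_congr fun z => ?_) h1
  rw [ENNReal.ofReal_div_of_pos hpos, ← div_eq_mul_inv]
  by_cases h0 : S.jointDensity y θt z = 0
  · simp [hsupp z h0]
  have hu : ∀ u : Fin (n + 1) → Fin m → Z, ENNReal.ofReal (P.csmcDensity θt z u) *
      ∑ k, ENNReal.ofReal (P.backwardProb θt (insertPath z u) k) * 1 =
      ENNReal.ofReal (P.csmcDensity θt z u) := by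
    intro u
    by_cases hu0 : P.csmcDensity θt z u = 0
    · simp [hu0]
    -- The central identity shows that `weightedFilterDensity` is nonzero wherever conditional SMC
    -- has positive density, so backward sampling is normalised there.
    have hG := P.weightedFilterDensity_mul_backwardProb_zero θt z u ▸ mul_ne_zero h0 hu0
    simp_rw [mul_one]
    rw [← ENNReal.ofReal_sum_of_nonneg fun k _ => P.backwardProb_nonneg _ _ _,
      P.sum_backwardProb (left_ne_zero_of_mul hG), ENNReal.ofReal_one, mul_one]
  exact (congrArg _ ((lintegral_congr hu).trans (P.lintegral_csmcDensity_eq_one θt z h0))).trans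
    (mul_one _)

theorem lintegral_one_div_averagedRatio (η : Θ → ℝ) (q : Θ → Θ → ℝ) (θ θ' θt : Θ)
    (hc : 0 ≤ q θ' θ * η θ' / (q θ θ' * η θ))
    (hint' : Integrable (S.jointDensity y θ') (Measure.pi fun _ : Fin (n + 1) => lam))
    (hpos : 0 < S.likelihood y θ)
    (hsupp : ∀ z, S.jointDensity y θt z = 0 → S.jointDensity y θ z = 0)
    (hsupp' : ∀ z, S.jointDensity y θt z = 0 → S.jointDensity y θ' z = 0)
    (hsupp'' : ∀ z, S.jointDensity y θ z = 0 → S.jointDensity y θ' z = 0) :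
    ∫⁻ x, ENNReal.ofReal (1 / P.averagedRatio η q θ' θ θt x.2.2 x.2.1) ∂(P.samplingLaw m θ θt) =
      ENNReal.ofReal (S.acceptRatio y η q θ θ') := by
  set c := q θ' θ * η θ' / (q θ θ' * η θ) with hcdef
  set A := P.meanDensityRatio (m := m) θ θt with hA
  set A' := P.meanDensityRatio (m := m) θ' θt with hA'
  let F : (Fin (n + 1) → Fin (m + 1) → Z) → ENNReal := fun ζ => ENNReal.ofReal (c * (A' ζ / A ζ))
  have hF : Measurable F := (measurable_const.mul ((P.measurable_meanDensityRatio θ' θt).div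
    (P.measurable_meanDensityRatio θ θt))).ennreal_ofReal
  have hFs : ∀ σ ζ, F (permuteParticles σ ζ) = F ζ := fun σ ζ => by
    simp only [F, hA, hA', P.meanDensityRatio_permuteParticles]
  -- Given `ζ`, only `p_θ'/p_θt` depends on the path drawn, and its backward mean is `A'`.
  have hback : ∀ ζ, ∑ k, ENNReal.ofReal (P.backwardProb θt ζ k) *
      ENNReal.ofReal (1 / P.averagedRatio η q θ' θ θt (selectPath ζ k) ζ) = F ζ := by
    intro ζ
    simp_rw [← ENNReal.ofReal_mul (P.backwardProb_nonneg θt ζ _), P.one_div_averagedRatio_eq]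
    have hterm : ∀ k, P.backwardProb θt ζ k * (c * (S.jointDensity y θ' (selectPath ζ k) /
        S.jointDensity y θt (selectPath ζ k) / A ζ)) = c * (P.backwardProb θt ζ k *
        (S.jointDensity y θ' (selectPath ζ k) / S.jointDensity y θt (selectPath ζ k)) / A ζ) :=
      fun k => by ring
    simp_rw [← hcdef, ← hA, hterm]
    rw [← ENNReal.ofReal_sum_of_nonneg fun k _ => mul_nonneg hc (div_nonneg
      (P.backwardProb_mul_densityRatio_nonneg θ' θt ζ k) (P.meanDensityRatio_nonneg θ θt ζ)),
      ← Finset.mul_sum, ← Finset.sum_div]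
    rfl
  have hAF : ∀ ζ, ENNReal.ofReal (A ζ * P.weightedFilterDensity θt ζ) * F ζ =
      ENNReal.ofReal (A' ζ * P.weightedFilterDensity θt ζ) * ENNReal.ofReal c := by
    intro ζ
    rw [← ENNReal.ofReal_mul (mul_nonneg (P.meanDensityRatio_nonneg _ _ _)
      (P.weightedFilterDensity_nonneg _ _)), ← ENNReal.ofReal_mul (mul_nonneg
      (P.meanDensityRatio_nonneg _ _ _) (P.weightedFilterDensity_nonneg _ _))]
    congr 1
    change A ζ * P.weightedFilterDensity θt ζ * (c * (A' ζ / A ζ)) =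
      A' ζ * P.weightedFilterDensity θt ζ * c
    by_cases h0 : A ζ = 0
    · have h0' : A' ζ = 0 := P.meanDensityRatio_eq_zero hsupp'' h0
      simp [h0, h0']
    · field_simp
  -- The change of measure is used forwards for `θ` with `F`, and, after `A` cancels, backwards for
  -- `θ'` with the constant `c`; the number of index vectors then drops out.
  have hkey := P.lintegral_csmcDensity_eq_lintegral_meanDensityRatio θ θt hsupp F hF hFs
  rw [lintegral_congr hAF, ← P.lintegral_csmcDensity_eq_lintegral_meanDensityRatio θ' θt hsupp'
    (fun _ => ENNReal.ofReal c) measurable_const fun _ _ => rfl] at hkey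
  rw [ENNReal.mul_right_inj (by simp) (by simp)] at hkey
  have hD : ∀ z, Measurable fun u : Fin (n + 1) → Fin m → Z =>
      ENNReal.ofReal (P.csmcDensity θt z u) := fun z =>
    ((P.measurable_csmcDensity θt).comp measurable_prodMk_left).ennreal_ofReal
  simp_rw [lintegral_mul_const _ (hD _), ← mul_assoc] at hkey
  rw [lintegral_mul_const' _ _ ENNReal.ofReal_ne_top,
    P.lintegral_jointDensity_mul_csmcDensity θ' θt hsupp', S.ofReal_likelihood y θ' hint'] at hkey
  rw [P.lintegral_samplingLaw θ θt
    (fun x => ENNReal.ofReal (1 / P.averagedRatio η q θ' θ θt x.2 x.1))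
    (measurable_const.div (P.measurable_averagedRatio η q θ θ' θt)).ennreal_ofReal]
  simp_rw [hback, ENNReal.ofReal_div_of_pos hpos, div_eq_mul_inv, mul_right_comm _
    (ENNReal.ofReal (S.likelihood y θ))⁻¹]
  rw [lintegral_mul_const' _ _ (by simpa using hpos), hkey, ← div_eq_mul_inv,
    ← ENNReal.ofReal_mul' hc, ← ENNReal.ofReal_div_of_pos hpos]
  congr 1
  rw [StateSpaceModel.acceptRatio, StateSpaceModel.posteriorParam, StateSpaceModel.posteriorParam,
    hcdef]
  simp only [div_eq_mul_inv, mul_inv]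
  ring

end ParticleScheme

end

theorem mainTheorem9 {Θ Y Z : Type*} [MeasurableSpace Z] (lam : Measure Z) [SigmaFinite lam]
    (S : StateSpaceModel Θ Y lam) (n m : ℕ) (y : Fin (n + 1) → Y) (P : ParticleScheme S y)
    (η : Θ → ℝ) (q : Θ → Θ → ℝ) (θ θ' θt : Θ)
    (hη : 0 < η θ) (hη' : 0 < η θ') (hq : 0 < q θ θ') (hq' : 0 < q θ' θ)
    (hint : Integrable (S.jointDensity y θ) (Measure.pi fun _ : Fin (n + 1) => lam))
    (hint' : Integrable (S.jointDensity y θ') (Measure.pi fun _ : Fin (n + 1) => lam))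
    (hpos : 0 < S.likelihood y θ)
    (hsupp : ∀ z, 0 < S.jointDensity y θ z ↔ 0 < S.jointDensity y θt z)
    (hsupp' : ∀ z, 0 < S.jointDensity y θ' z ↔ 0 < S.jointDensity y θt z) :
    IsProbabilityMeasure (P.samplingLaw m θ θt) ∧
    Integrable (fun x => 1 / P.averagedRatio η q θ' θ θt x.2.2 x.2.1) (P.samplingLaw m θ θt) ∧
    ∫ x, 1 / P.averagedRatio η q θ' θ θt x.2.2 x.2.1 ∂(P.samplingLaw m θ θt) =
      S.acceptRatio y η q θ θ' := by
  have hiff : ∀ ϑ z, S.jointDensity y ϑ z = 0 ↔ ¬ 0 < S.jointDensity y ϑ z := fun ϑ z =>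
    (S.jointDensity_nonneg y ϑ z).not_lt_iff_eq'.symm
  have h1 : ∀ z, S.jointDensity y θt z = 0 → S.jointDensity y θ z = 0 := fun z => by
    rw [hiff, hiff, hsupp]
    exact id
  have h2 : ∀ z, S.jointDensity y θt z = 0 → S.jointDensity y θ' z = 0 := fun z => by
    rw [hiff, hiff, hsupp']
    exact id
  have h3 : ∀ z, S.jointDensity y θ z = 0 → S.jointDensity y θ' z = 0 := fun z => by
    rw [hiff, hiff, hsupp, hsupp']
    exact id
  have hc : 0 < q θ' θ * η θ' / (q θ θ' * η θ) := by positivity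
  have hlint := P.lintegral_one_div_averagedRatio (m := m) η q θ θ' θt hc.le hint' hpos h1 h2 h3
  have hmeas : Measurable fun x : (Fin (n + 1) → Z) × (Fin (n + 1) → Fin (m + 1) → Z) ×
      (Fin (n + 1) → Z) => 1 / P.averagedRatio η q θ' θ θt x.2.2 x.2.1 :=
    measurable_const.div ((P.measurable_averagedRatio η q θ θ' θt).comp measurable_snd)
  have hnn : ∀ x : (Fin (n + 1) → Z) × (Fin (n + 1) → Fin (m + 1) → Z) × (Fin (n + 1) → Z),
      0 ≤ 1 / P.averagedRatio η q θ' θ θt x.2.2 x.2.1 := fun x => by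
    rw [P.one_div_averagedRatio_eq]
    exact mul_nonneg hc.le (div_nonneg (div_nonneg (S.jointDensity_nonneg _ _ _)
      (S.jointDensity_nonneg _ _ _)) (P.meanDensityRatio_nonneg _ _ _))
  refine ⟨P.isProbabilityMeasure_samplingLaw θ θt hint hpos h1, ⟨hmeas.aestronglyMeasurable, ?_⟩, ?_⟩
  · rw [hasFiniteIntegral_iff_ofReal (ae_of_all _ hnn), hlint]
    exact ENNReal.ofReal_lt_top
  · rw [integral_eq_lintegral_of_nonneg_ae (ae_of_all _ hnn) hmeas.aestronglyMeasurable, hlint]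
    refine ENNReal.toReal_ofReal (div_nonneg (mul_nonneg hq'.le (mul_nonneg hη'.le ?_))
      (mul_nonneg hq.le (mul_nonneg hη.le hpos.le)))
    exact integral_nonneg (S.jointDensity_nonneg y θ')
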